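/- Let $d\ge 1$, let $\mathbb{T}^d=(\mathbb{R}/\mathbb{Z})^d$, $H^0=L^2(\mathbb{T}^d)$ (complex-valued functions), and let $H^2=H^2(\mathbb{T}^d)$ be the Sobolev space of functions with $\sum_{k\in\mathbb{Z}^d}(1+4\pi^2|k|^2)^2|\hat u(k)|^2<\infty$. Let $\{K^\lambda\}_{\lambda\in[0,1)}$ be a family of operators on $H^0$ such that (H1) each $K^\lambda$ is bounded and selfadjoint, and $\sup_{\lambda\in[0,1)}\|K^\lambda\|<\infty$; (H2) for every $\sigma\in[0,1)$ and $u\in H^0$, $\|K^\lambda u-K^\sigma u\|\to0$ as $\lambda\to\sigma$ in $[0,1)$. Put $A^\lambda=-\Delta+K^\lambda$, with domain $H^2$, and $A=A^0$. Let $(\alpha_i,v_i)$, $i=1,2,\dots$, be the eigenvalue-eigenvector pairs of $A$ listed in ascending order, counting multiplicity: the $v_i\in H^2$ are orthonormal in $H^0$, $Av_i=\alpha_iv_i$, $\alpha_1\le\alpha_2\le\cdots$, and every eigenspace of $A$ is spanned by the $v_i$ that belong to it. Let $P_n$ be the orthogonal projection of $H^0$ onto $R(P_n)=\mathrm{span}\{v_1,\dots,v_n\}\subset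 H^2$, let $A_n^\lambda=P_nA^\lambda P_n$, regarded as an operator on the $n$-dimensional space $R(P_n)$, and let $A_n=A_n^0$. Denote by $neg(T)$ the number of negative eigenvalues of $T$, counting multiplicity, and by $\rho(T)$ its resolvent set. Suppose that $0\in\rho(A)$. Then: 1. there exist $\lambda^*\in(0,1]$ and $N\in\mathbb{N}$ such that $$0\in\rho(A_n^\lambda)\quad\text{for all } n>N \text{ and all } 0<\lambda<\lambda^*; \qquad (\ast)$$ 2. for every $\lambda^*\in(0,1]$ and $N\in\mathbb{N}$ for which $(\ast)$ holds, one has $neg(A_n^\lambda)=neg(A_n)$ for all $0<\lambda<\lambda^*$ and all $n>N$. In particular, there are $\lambda^*>0$ and $N$ such that $neg(A_n^\lambda)=neg(A_n)$ for all $0<\lambda<\lambda^*$ and all $n>N$. -/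

import Mathlib

open Filter Topology MeasureTheory Set
open scoped ENNReal

noncomputable section

-- Normalised Haar measure on the circle ℝ/ℤ, as in Mathlib's multivariate Fourier series.
attribute [local instance] instMeasureSpaceUnitAddCircle

namespace TorusSchrodinger

/-- `H⁰ = L²(𝕋ᵈ)`: square integrable complex functions on the torus `𝕋ᵈ = (ℝ/ℤ)ᵈ`. -/
abbrev L2Torus (d : ℕ) : Type := Lp ℂ 2 (volume : Measure (UnitAddTorus (Fin d)))

/-- The `k`-th Fourier coefficient `û(k) = ∫ u(x) exp(-2πi k·x) dx` of `u ∈ L²(𝕋ᵈ)`. -/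
def fourierCoefficient {d : ℕ} (u : L2Torus d) (k : Fin d → ℤ) : ℂ :=
  UnitAddTorus.mFourierCoeff u k

/-- The coefficients are the coordinates in the Hilbert basis of exponentials. -/
theorem repr_eq_fourierCoefficient {d : ℕ} (u : L2Torus d) (k : Fin d → ℤ) :
    UnitAddTorus.mFourierBasis.repr u k = fourierCoefficient u k :=
  UnitAddTorus.mFourierBasis_repr u k

/-- The symbol `4π²|k|²` of `-Δ`: one has `-Δ exp(2πi k·x) = 4π²|k|² exp(2πi k·x)`. -/
def laplaceSymbol {d : ℕ} (k : Fin d → ℤ) : ℝ := 4 * Real.pi ^ 2 * ∑ i, (k i : ℝ) ^ 2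

theorem fourierCoefficient_add {d : ℕ} (u v : L2Torus d) (k : Fin d → ℤ) :
    fourierCoefficient (u + v) k = fourierCoefficient u k + fourierCoefficient v k := by
  simp [← repr_eq_fourierCoefficient]

theorem fourierCoefficient_smul {d : ℕ} (c : ℂ) (u : L2Torus d) (k : Fin d → ℤ) :
    fourierCoefficient (c • u) k = c * fourierCoefficient u k := by
  simp [← repr_eq_fourierCoefficient]

/-- The Sobolev space `H²(𝕋ᵈ)`, as a subspace of `L²(𝕋ᵈ)`:
the functions `u` with `∑ₖ (1 + 4π²|k|²)² |û(k)|² < ∞`. -/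
def sobolevH2 (d : ℕ) : Submodule ℂ (L2Torus d) where
  carrier := {u | Memℓp (fun k => (1 + (laplaceSymbol k : ℂ)) * fourierCoefficient u k) 2}
  zero_mem' := by
    have h : ∀ k : Fin d → ℤ, fourierCoefficient (0 : L2Torus d) k = 0 := fun k => by
      simp [← repr_eq_fourierCoefficient]
    simp only [Set.mem_ofPred_eq, h, mul_zero]
    exact zero_memℓp
  add_mem' := by
    intro u v hu hv
    simp only [Set.mem_ofPred_eq, fourierCoefficient_add, mul_add] at hu hv ⊢
    exact Memℓp.add hu hv
  smul_mem' := by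
    intro c u hu
    simp only [Set.mem_ofPred_eq, fourierCoefficient_smul] at hu ⊢
    have := Memℓp.const_smul hu c
    convert this using 2 with k
    simp only [Pi.smul_apply, smul_eq_mul]
    ring

theorem memℓp_laplaceSymbol_mul {d : ℕ} (u : sobolevH2 d) :
    Memℓp (fun k => (laplaceSymbol k : ℂ) * fourierCoefficient (u : L2Torus d) k) 2 := by
  have h1 : Memℓp (fun k => (1 + (laplaceSymbol k : ℂ)) *
      fourierCoefficient (u : L2Torus d) k) 2 := u.2
  have h2 : Memℓp (fun k => fourierCoefficient (u : L2Torus d) k) 2 := by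
    simp only [← repr_eq_fourierCoefficient]
    exact lp.memℓp (UnitAddTorus.mFourierBasis.repr (u : L2Torus d))
  convert h1.sub h2 using 2 with k
  simp only [Pi.sub_apply]
  ring

/-- The (nonnegative) Laplacian `-Δ : H²(𝕋ᵈ) → L²(𝕋ᵈ)`: the Fourier coefficients of `-Δu` are
`4π²|k|² û(k)`. -/
def negLaplacian (d : ℕ) : sobolevH2 d →ₗ[ℂ] L2Torus d where
  toFun u := UnitAddTorus.mFourierBasis.repr.symm
    ⟨fun k => (laplaceSymbol k : ℂ) * fourierCoefficient (u : L2Torus d) k,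
      memℓp_laplaceSymbol_mul u⟩
  map_add' u v := by
    rw [← map_add]
    congr 1
    ext k
    simp only [Submodule.coe_add, fourierCoefficient_add, mul_add]
    rfl
  map_smul' c u := by
    rw [RingHom.id_apply, ← map_smul]
    congr 1
    ext k
    simp [fourierCoefficient_smul, mul_left_comm]

theorem fourierCoefficient_negLaplacian {d : ℕ} (u : sobolevH2 d) (k : Fin d → ℤ) :
    fourierCoefficient (negLaplacian d u) k
      = (laplaceSymbol k : ℂ) * fourierCoefficient (u : L2Torus d) k := by
  simp [← repr_eq_fourierCoefficient, negLaplacian]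

/-- The Schrödinger operator `-Δ + K` in `L²(𝕋ᵈ)`, with domain `H²(𝕋ᵈ)`. -/
def schrodinger {d : ℕ} (K : L2Torus d →L[ℂ] L2Torus d) : L2Torus d →ₗ.[ℂ] L2Torus d where
  domain := sobolevH2 d
  toFun := negLaplacian d + (K : L2Torus d →ₗ[ℂ] L2Torus d) ∘ₗ (sobolevH2 d).subtype

/-- `σ ∈ ρ(T)` for an operator `T` in `H` with domain `T.domain`: the map `T - σ` from the domain
to `H` has an everywhere defined bounded two-sided inverse `R`. -/
def MemResolventSet {H : Type*} [NormedAddCommGroup H] [InnerProductSpace ℂ H]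
    (σ : ℂ) (T : H →ₗ.[ℂ] H) : Prop :=
  ∃ R : H →L[ℂ] H,
    (∀ f : H, ∃ u : T.domain, (u : H) = R f ∧ T u - σ • (u : H) = f) ∧
    (∀ u : T.domain, R (T u - σ • (u : H)) = u)

/-- Hypothesis (H1): the operators `K^λ`, `λ ∈ [0,1)`, are bounded and selfadjoint,
with uniformly bounded norms. -/
def HypH1 {d : ℕ} (K : ℝ → L2Torus d →L[ℂ] L2Torus d) : Prop :=
  (∀ l ∈ Ico (0 : ℝ) 1, IsSelfAdjoint (K l)) ∧ ∃ C : ℝ, ∀ l ∈ Ico (0 : ℝ) 1, ‖K l‖ ≤ C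

/-- Hypothesis (H2): for every `σ ∈ [0,1)`, `K^λ → K^σ` strongly as `λ → σ` in `[0,1)`. -/
def HypH2 {d : ℕ} (K : ℝ → L2Torus d →L[ℂ] L2Torus d) : Prop :=
  ∀ σ ∈ Ico (0 : ℝ) 1, ∀ u : L2Torus d,
    Tendsto (fun l => K l u) (𝓝[Ico (0 : ℝ) 1] σ) (𝓝 (K σ u))

/-- `(α i, v i)`, `i = 0, 1, 2, …`, lists the eigenvalue-eigenvector pairs of `T` in ascending
order, counting multiplicity: the `v i` are orthonormal eigenvectors, the eigenvalues `α i` are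
ascending, and every eigenspace of `T` is spanned by the `v i` that belong to it. -/
structure IsEigenpairList {H : Type*} [NormedAddCommGroup H] [InnerProductSpace ℂ H]
    (T : H →ₗ.[ℂ] H) (α : ℕ → ℝ) (v : ℕ → T.domain) : Prop where
  monotone : Monotone α
  orthonormal : Orthonormal ℂ (fun i => (v i : H))
  eigen : ∀ i, T (v i) = (α i : ℂ) • (v i : H)
  exhaustive : ∀ (μ : ℂ) (u : T.domain), T u = μ • (u : H) →
    (u : H) ∈ Submodule.span ℂ {w : H | ∃ i, (α i : ℂ) = μ ∧ (v i : H) = w}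

/-- The span of the first `n` of the vectors `v i`; with `v` as above, this is the range
`R(P_n)` of the projection onto the first `n` eigenvectors. -/
def firstSpan {H : Type*} [NormedAddCommGroup H] [InnerProductSpace ℂ H] {D : Submodule ℂ H}
    (v : ℕ → D) (n : ℕ) : Submodule ℂ H :=
  Submodule.span ℂ (Set.range fun i : Fin n => (v i : H))

instance {H : Type*} [NormedAddCommGroup H] [InnerProductSpace ℂ H] {D : Submodule ℂ H}
    (v : ℕ → D) (n : ℕ) : FiniteDimensional ℂ (firstSpan v n) :=
  FiniteDimensional.span_of_finite ℂ (Set.finite_range _)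

theorem firstSpan_le {H : Type*} [NormedAddCommGroup H] [InnerProductSpace ℂ H]
    {D : Submodule ℂ H} (v : ℕ → D) (n : ℕ) : firstSpan v n ≤ D := by
  refine Submodule.span_le.2 ?_
  rintro _ ⟨i, rfl⟩
  exact (v i).2

/-- The truncated operator `P_n T P_n`, as an operator on the `n`-dimensional range of `P_n`,
where `P_n` is the orthogonal projection of `H` onto the span of the first `n` vectors `v i`. -/
def truncation {H : Type*} [NormedAddCommGroup H] [InnerProductSpace ℂ H]
    (T : H →ₗ.[ℂ] H) (v : ℕ → T.domain) (n : ℕ) : Module.End ℂ (firstSpan v n) :=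
  ((firstSpan v n).orthogonalProjectionOnto : H →ₗ[ℂ] firstSpan v n) ∘ₗ T.toFun ∘ₗ
    Submodule.inclusion (firstSpan_le v n)

/-- The truncated Schrödinger operator `P_n (-Δ + K) P_n` on the range of `P_n`. -/
def truncSchrodinger {d : ℕ} (K : L2Torus d →L[ℂ] L2Torus d) (v : ℕ → sobolevH2 d) (n : ℕ) :
    Module.End ℂ (firstSpan v n) :=
  truncation (schrodinger K) v n

/-- `neg T`: the number of negative eigenvalues, counting multiplicity, of an operator on a
finite-dimensional space, i.e. the sum of the dimensions of its eigenspaces with negative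
eigenvalue. -/
def neg {V : Type*} [AddCommGroup V] [Module ℂ V] (T : Module.End ℂ V) : ℕ :=
  ∑ᶠ μ : {x : ℝ // x < 0}, Module.finrank ℂ (T.eigenspace ((μ : ℝ) : ℂ))

/-- `λ*` and `N` are admissible at `σ`: `0 < λ* ≤ 1`, and `σ` is in the resolvent set of
the truncation of `-Δ + K^λ` to `R(P_n)` for all `n > N` and all `0 < λ < λ*`. -/
def IsAdmissible {d : ℕ} (K : ℝ → L2Torus d →L[ℂ] L2Torus d) (v : ℕ → sobolevH2 d)
    (σ : ℂ) (lstar : ℝ) (N : ℕ) : Prop :=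
  0 < lstar ∧ lstar ≤ 1 ∧ ∀ n > N, ∀ l ∈ Ioo 0 lstar,
    σ ∈ resolventSet ℂ (truncSchrodinger (K l) v n)

end TorusSchrodinger

end

/-! Write B = K^λ - K^0. Two facts carry the theorem.

Invertibility: A⁻¹ maps L² boundedly into H², hence is compact on L², and compactness turns strong
convergence B → 0 into norm convergence B A⁻¹ → 0 (`eventually_norm_apply_resolvent_le`). Since
R(P_n) is A-invariant, P_n(A + B)u = 0 with f = Au in R(P_n) reads f = -P_n B A⁻¹ f. Once ‖B A⁻¹‖ <
1 this forces f = 0, for every n at once (`zero_mem_resolventSet_truncSchrodinger`).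

Constancy of the count: for fixed n, λ ↦ A_n^λ is a continuous path of invertible Hermitian matrices
on [0, λ*). No eigenvalue can cross 0, so the negative count is locally constant, hence constant
(`neg_eq_of_isPreconnected`). -/

namespace TorusSchrodinger

/-! ### Counting negative eigenvalues in finite dimension -/

section Inertia

variable {V : Type*} [NormedAddCommGroup V] [InnerProductSpace ℂ V]

/-- Coordinates of a vector in the span of part of an orthonormal basis. -/
theorem repr_eq_zero_of_mem_span {ι : Type*} [Fintype ι] (b : OrthonormalBasis ι ℂ V)
    {s : Finset ι} {u : V} (hu : u ∈ Submodule.span ℂ (b '' s)) {i : ι} (hi : i ∉ s) :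
    b.repr u i = 0 := by
  rw [b.repr_apply_apply]
  induction hu using Submodule.span_induction with
  | mem x hx =>
    obtain ⟨j, hj, rfl⟩ := hx
    exact b.orthonormal.2 fun h => hi (h ▸ hj)
  | zero => simp
  | add x y _ _ hx hy => rw [inner_add_right, hx, hy, add_zero]
  | smul c x _ hx => rw [inner_smul_right, hx, mul_zero]

theorem finrank_span_image_orthonormalBasis {ι : Type*} [Fintype ι] (b : OrthonormalBasis ι ℂ V)
    (s : Finset ι) : Module.finrank ℂ (Submodule.span ℂ (b '' s)) = s.card := by
  have h : b '' s = Set.range fun i : s => b i := by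
    ext x; simp
  rw [h, finrank_span_eq_card, Fintype.card_coe]
  exact b.orthonormal.linearIndependent.comp _ Subtype.val_injective

theorem sum_norm_sq_repr {ι : Type*} [Fintype ι] (b : OrthonormalBasis ι ℂ V) (u : V) :
    ∑ i, ‖b.repr u i‖ ^ 2 = ‖u‖ ^ 2 := by
  rw [← b.repr.norm_map, EuclideanSpace.norm_sq_eq]

variable [FiniteDimensional ℂ V] {n : ℕ}

/-- The number of negative eigenvalues, in terms of the sorted list of eigenvalues. -/
theorem neg_eq_card_eigenvalues_neg {T : Module.End ℂ V} (hT : T.IsSymmetric)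
    (hn : Module.finrank ℂ V = n) :
    neg T = Finset.card {i | hT.eigenvalues hn i < 0} := by
  classical
  set s : Finset (Fin n) := {i | hT.eigenvalues hn i < 0} with hs
  have hfib : ∀ μ : {x : ℝ // x < 0}, Module.finrank ℂ (T.eigenspace ((μ : ℝ) : ℂ)) =
      Finset.card {i ∈ s | hT.eigenvalues hn i = μ} := by
    rintro ⟨μ, hμ⟩
    rw [← hT.card_filter_eigenvalues_eq hn, hs, Finset.filter_filter]
    congr 1
    ext i
    simp only [Finset.mem_filter, Finset.mem_univ, true_and]
    constructor
    · intro h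
      have h' : hT.eigenvalues hn i = μ := Complex.ofReal_injective h
      exact ⟨h' ▸ hμ, h'⟩
    · rintro ⟨-, h⟩
      exact congrArg _ h
  -- Sorting the negative indices by their eigenvalue turns the sum of multiplicities into a sum of
  -- fibre cardinalities.
  let e : s → {x : ℝ // x < 0} := fun i => ⟨hT.eigenvalues hn i, by
    have := i.2
    simp only [hs, Finset.mem_filter] at this
    exact this.2⟩
  have hsupp : (Function.support fun μ : {x : ℝ // x < 0} =>
      Finset.card {i ∈ s | hT.eigenvalues hn i = μ}) ⊆
      ((Finset.univ.image e : Finset {x : ℝ // x < 0}) : Set {x : ℝ // x < 0}) := by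
    intro μ hμ
    rw [Function.mem_support, Finset.card_ne_zero] at hμ
    obtain ⟨i, hi⟩ := hμ
    rw [Finset.mem_filter] at hi
    rw [Finset.mem_coe, Finset.mem_image]
    exact ⟨⟨i, hi.1⟩, Finset.mem_univ _, Subtype.ext hi.2⟩
  rw [neg, finsum_congr hfib, finsum_eq_sum_of_support_subset _ hsupp]
  have hcard := Finset.card_eq_sum_card_fiberwise (s := (Finset.univ : Finset s)) (f := e)
    (t := Finset.univ.image e) (fun i _ => by simp)
  rw [Finset.card_univ, Fintype.card_coe] at hcard
  rw [hcard]
  refine Finset.sum_congr rfl fun μ _ => ?_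
  rw [← Finset.card_map (Function.Embedding.subtype (· ∈ s))]
  congr 1
  ext i
  simp only [Finset.mem_filter, Finset.mem_map, Finset.mem_univ, true_and,
    Function.Embedding.subtype_apply]
  constructor
  · rintro ⟨h1, h2⟩
    exact ⟨⟨i, h1⟩, Subtype.ext h2, rfl⟩
  · rintro ⟨a, h1, rfl⟩
    exact ⟨a.2, congrArg Subtype.val h1⟩

/-- The quadratic form of a symmetric operator in an eigenbasis. -/
theorem re_inner_apply_self_eq_sum {T : Module.End ℂ V} (hT : T.IsSymmetric)
    (hn : Module.finrank ℂ V = n) (u : V) :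
    (inner ℂ (T u) u).re =
      ∑ i, hT.eigenvalues hn i * ‖(hT.eigenvectorBasis hn).repr u i‖ ^ 2 := by
  rw [← (hT.eigenvectorBasis hn).repr.inner_map_map, PiLp.inner_apply, Complex.re_sum]
  refine Finset.sum_congr rfl fun i _ => ?_
  rw [hT.eigenvectorBasis_apply_self_apply hn]
  simp only [RCLike.inner_apply, map_mul, Complex.coe_algebraMap]
  rw [mul_left_comm, RCLike.mul_conj, Complex.conj_ofReal]
  norm_cast
  exact Complex.re_ofReal_mul _ _

theorem re_inner_le_of_mem_span {T : Module.End ℂ V} (hT : T.IsSymmetric)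
    (hn : Module.finrank ℂ V = n) {c : ℝ} {s : Finset (Fin n)}
    (hs : ∀ i ∈ s, hT.eigenvalues hn i ≤ c) {u : V}
    (hu : u ∈ Submodule.span ℂ (hT.eigenvectorBasis hn '' s)) :
    (inner ℂ (T u) u).re ≤ c * ‖u‖ ^ 2 := by
  rw [re_inner_apply_self_eq_sum hT hn, ← sum_norm_sq_repr (hT.eigenvectorBasis hn) u,
    Finset.mul_sum]
  refine Finset.sum_le_sum fun i _ => ?_
  by_cases hi : i ∈ s
  · exact mul_le_mul_of_nonneg_right (hs i hi) (by positivity)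
  · simp [repr_eq_zero_of_mem_span _ hu hi]

theorem le_re_inner_of_mem_span {T : Module.End ℂ V} (hT : T.IsSymmetric)
    (hn : Module.finrank ℂ V = n) {c : ℝ} {s : Finset (Fin n)}
    (hs : ∀ i ∈ s, c ≤ hT.eigenvalues hn i) {u : V}
    (hu : u ∈ Submodule.span ℂ (hT.eigenvectorBasis hn '' s)) :
    c * ‖u‖ ^ 2 ≤ (inner ℂ (T u) u).re := by
  rw [re_inner_apply_self_eq_sum hT hn, ← sum_norm_sq_repr (hT.eigenvectorBasis hn) u,
    Finset.mul_sum]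
  refine Finset.sum_le_sum fun i _ => ?_
  by_cases hi : i ∈ s
  · exact mul_le_mul_of_nonneg_right (hs i hi) (by positivity)
  · simp [repr_eq_zero_of_mem_span _ hu hi]

/-- Orthonormality makes the cardinalities dimensions, and subspaces meeting only in 0 have
dimensions adding up to at most n. This replaces a min-max argument in comparing two spectra. -/
theorem card_add_card_le_of_disjoint_span (b b' : OrthonormalBasis (Fin n) ℂ V)
    {s t : Finset (Fin n)}
    (h : ∀ u ∈ Submodule.span ℂ (b '' s), u ∈ Submodule.span ℂ (b' '' t) → u = 0) :
    s.card + t.card ≤ n := by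
  rw [← finrank_span_image_orthonormalBasis b s, ← finrank_span_image_orthonormalBasis b' t]
  refine (Submodule.finrank_add_finrank_le_of_disjoint
    (Submodule.disjoint_def.2 h)).trans_eq ?_
  rw [Module.finrank_eq_card_basis b.toBasis, Fintype.card_fin]

/-- Symmetric perturbations smaller than the spectral gap at `0` do not change the number of
negative eigenvalues, as long as `0` is not an eigenvalue. -/
theorem neg_eq_of_norm_sub_le {T T' : Module.End ℂ V} (hT : T.IsSymmetric) (hT' : T'.IsSymmetric)
    (hn : Module.finrank ℂ V = n) {c δ : ℝ} (hδc : δ < c)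
    (hc : ∀ i, c ≤ |hT.eigenvalues hn i|)
    (hclose : ∀ u, ‖T' u - T u‖ ≤ δ * ‖u‖) : neg T' = neg T := by
  rw [neg_eq_card_eigenvalues_neg hT hn, neg_eq_card_eigenvalues_neg hT' hn]
  have hre : ∀ u : V, |(inner ℂ (T' u) u).re - (inner ℂ (T u) u).re| ≤ δ * ‖u‖ ^ 2 := by
    intro u
    rw [← Complex.sub_re, ← inner_sub_left]
    calc _ ≤ ‖inner ℂ (T' u - T u) u‖ := Complex.abs_re_le_norm _
      _ ≤ ‖T' u - T u‖ * ‖u‖ := norm_inner_le_norm _ _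
      _ ≤ δ * ‖u‖ * ‖u‖ := by gcongr; exact hclose u
      _ = _ := by ring
  have hzero : ∀ u : V, c * ‖u‖ ^ 2 ≤ δ * ‖u‖ ^ 2 → u = 0 := by
    intro u hu
    by_contra hne
    have : 0 < ‖u‖ ^ 2 := by positivity
    nlinarith
  have hsplit : ∀ {S : Module.End ℂ V} (hS : S.IsSymmetric),
      Finset.card {i | hS.eigenvalues hn i < 0} +
        Finset.card {i | ¬ hS.eigenvalues hn i < 0} = n := by
    intro S hS
    rw [Finset.card_filter_add_card_filter_not, Finset.card_univ, Fintype.card_fin]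
  -- On the intersection the form of `T` is at most -c‖u‖² and that of `T'` is nonnegative, yet they
  -- differ by at most δ‖u‖². With `hsplit` this gives `neg T ≤ neg T'`; `h2` is the reverse.
  have h1 : Finset.card {i | hT.eigenvalues hn i < 0} +
      Finset.card {i | ¬ hT'.eigenvalues hn i < 0} ≤ n := by
    refine card_add_card_le_of_disjoint_span (hT.eigenvectorBasis hn) (hT'.eigenvectorBasis hn)
      fun u hu hu' => hzero u ?_
    have a1 := re_inner_le_of_mem_span hT hn (c := -c) (fun i hi => by
      rw [Finset.mem_filter] at hi
      have := hc i
      rw [abs_of_neg hi.2] at this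
      linarith) hu
    have a2 := le_re_inner_of_mem_span hT' hn (c := 0) (fun i hi => by
      rw [Finset.mem_filter] at hi
      exact not_lt.1 hi.2) hu'
    have a3 := abs_le.1 (hre u)
    linarith [a3.2]
  have h2 : Finset.card {i | ¬ hT.eigenvalues hn i < 0} +
      Finset.card {i | hT'.eigenvalues hn i < 0} ≤ n := by
    refine card_add_card_le_of_disjoint_span (hT.eigenvectorBasis hn) (hT'.eigenvectorBasis hn)
      fun u hu hu' => hzero u ?_
    have a1 := le_re_inner_of_mem_span hT hn (c := c) (fun i hi => by
      rw [Finset.mem_filter] at hi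
      have := hc i
      rwa [abs_of_nonneg (not_lt.1 hi.2)] at this) hu
    have a2 := re_inner_le_of_mem_span hT' hn (c := 0) (fun i hi => by
      rw [Finset.mem_filter] at hi
      exact hi.2.le) hu'
    have a3 := abs_le.1 (hre u)
    linarith [a3.1]
  have h3 := hsplit hT
  have h4 := hsplit hT'
  omega

theorem eigenvalues_ne_zero_of_mem_resolventSet {T : Module.End ℂ V} (hT : T.IsSymmetric)
    (hn : Module.finrank ℂ V = n) (h0 : (0 : ℂ) ∈ resolventSet ℂ T) (i : Fin n) :
    hT.eigenvalues hn i ≠ 0 := by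
  intro hi
  have h := (hT.hasEigenvalue_eigenvalues hn i).mem_spectrum
  rw [hi] at h
  exact h h0

/-- Along a strongly continuous path of invertible symmetric operators on a finite-dimensional
space, the number of negative eigenvalues is constant. -/
theorem neg_eq_of_isPreconnected {X : Type*} [TopologicalSpace X] {S : Set X}
    (hS : IsPreconnected S) {T : X → Module.End ℂ V} (hT : ∀ x ∈ S, (T x).IsSymmetric)
    (hcont : ∀ u, ContinuousOn (fun x => T x u) S)
    (h0 : ∀ x ∈ S, (0 : ℂ) ∈ resolventSet ℂ (T x)) {x y : X} (hx : x ∈ S) (hy : y ∈ S) :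
    neg (T x) = neg (T y) := by
  refine hS.constant (f := fun x => neg (T x)) (fun σ hσ => ?_) hx hy
  refine tendsto_const_nhds.congr' ?_
  have hTσ := hT σ hσ
  have hn : Module.finrank ℂ V = Module.finrank ℂ V := rfl
  obtain ⟨c, hc0, hc⟩ : ∃ c > 0, ∀ i, c ≤ |hTσ.eigenvalues hn i| := by
    rcases isEmpty_or_nonempty (Fin (Module.finrank ℂ V)) with h | h
    -- On the zero space any positive gap will do; otherwise c is the least modulus of an
    -- eigenvalue.
    · exact ⟨1, one_pos, fun i => h.elim i⟩
    · obtain ⟨i, hi⟩ := Finite.exists_min fun i => |hTσ.eigenvalues hn i|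
      exact ⟨_, abs_pos.2 (eigenvalues_ne_zero_of_mem_resolventSet hTσ hn (h0 σ hσ) i), hi⟩
  set b := hTσ.eigenvectorBasis hn
  -- In finite dimension, convergence on a basis controls the operator norm: this sum serves as δ.
  have hlim : Tendsto (fun x => ∑ i, ‖T x (b i) - T σ (b i)‖) (𝓝[S] σ) (𝓝 0) := by
    have : Tendsto (fun x => ∑ i, ‖T x (b i) - T σ (b i)‖) (𝓝[S] σ)
        (𝓝 (∑ i, ‖T σ (b i) - T σ (b i)‖)) :=
      tendsto_finsetSum _ fun i _ => ((hcont (b i) σ hσ).sub_const _).norm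
    simpa using this
  filter_upwards [hlim.eventually_lt_const hc0, self_mem_nhdsWithin] with x hxc hxS
  refine (neg_eq_of_norm_sub_le hTσ (hT x hxS) hn hxc hc fun u => ?_).symm
  calc ‖T x u - T σ u‖ = ‖∑ i, b.repr u i • (T x (b i) - T σ (b i))‖ := by
        conv_lhs => rw [← b.sum_repr u]
        simp only [map_sum, map_smul, smul_sub, Finset.sum_sub_distrib]
    _ ≤ ∑ i, ‖b.repr u i • (T x (b i) - T σ (b i))‖ := norm_sum_le _ _
    _ ≤ ∑ i, ‖T x (b i) - T σ (b i)‖ * ‖u‖ := by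
        refine Finset.sum_le_sum fun i _ => ?_
        rw [norm_smul, mul_comm]
        gcongr
        rw [← b.repr.norm_map u]
        exact PiLp.norm_apply_le _ i
    _ = _ := by rw [Finset.sum_mul]

end Inertia

/-! ### Fourier truncation and compactness of H² in L² -/

section Torus

variable {d : ℕ}

theorem laplaceSymbol_nonneg (k : Fin d → ℤ) : 0 ≤ laplaceSymbol k := by
  unfold laplaceSymbol
  positivity

/-- The source of compactness: only finitely many frequencies lie below a given energy. For integers
|kᵢ| ≤ kᵢ², which the symbol dominates. -/
theorem finite_laplaceSymbol_le (C : ℝ) : {k : Fin d → ℤ | laplaceSymbol k ≤ C}.Finite := by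
  refine (Set.finite_Icc (fun _ : Fin d => -⌈C⌉) (fun _ => ⌈C⌉)).subset fun k hk => ?_
  have hbound : ∀ i, |k i| ≤ ⌈C⌉ := by
    intro i
    have h1 : (k i : ℝ) ^ 2 ≤ ∑ j, (k j : ℝ) ^ 2 :=
      Finset.single_le_sum (f := fun j => (k j : ℝ) ^ 2) (fun _ _ => sq_nonneg _)
        (Finset.mem_univ i)
    have h2 : (1 : ℝ) ≤ 4 * Real.pi ^ 2 := by nlinarith [Real.pi_gt_three]
    have h3 : ∑ j, (k j : ℝ) ^ 2 ≤ laplaceSymbol k :=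
      le_mul_of_one_le_left (Finset.sum_nonneg fun _ _ => sq_nonneg _) h2
    have h4 : ((k i ^ 2 : ℤ) : ℝ) ≤ (⌈C⌉ : ℝ) := by
      push_cast
      exact (h1.trans h3).trans (le_trans hk (Int.le_ceil C))
    have h5 : k i ^ 2 ≤ ⌈C⌉ := by exact_mod_cast h4
    rw [← sq_abs] at h5
    exact (Int.le_self_sq _).trans h5
  exact ⟨fun i => (abs_le.1 (hbound i)).1, fun i => (abs_le.1 (hbound i)).2⟩

theorem norm_le_of_forall_norm_repr_le {ι E : Type*} [NormedAddCommGroup E]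
    [InnerProductSpace ℂ E] (b : HilbertBasis ι ℂ E) {x y : E}
    (h : ∀ k, ‖b.repr x k‖ ≤ ‖b.repr y k‖) : ‖x‖ ≤ ‖y‖ := by
  rw [← b.repr.norm_map x, ← b.repr.norm_map y]
  exact lp.norm_mono two_ne_zero h

/-- Quantitative compactness of the embedding of `H²` into `L²`: the resolvent of the Laplacian is
uniformly approximated by Fourier truncations. -/
theorem exists_finset_norm_sub_fourier_sum_le {ε : ℝ} (hε : 0 < ε) :
    ∃ F : Finset (Fin d → ℤ), ∀ u g : L2Torus d,
      (∀ k, fourierCoefficient g k = (1 + (laplaceSymbol k : ℂ)) * fourierCoefficient u k) →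
      ‖u - ∑ k ∈ F, fourierCoefficient u k • UnitAddTorus.mFourierBasis k‖ ≤ ε * ‖g‖ := by
  classical
  -- Beyond the cutoff ε⁻¹ one has ε(1 + symbol) ≥ 1, so each remaining coefficient of u is bounded
  -- by that of εg.
  refine ⟨(finite_laplaceSymbol_le (d := d) ε⁻¹).toFinset, fun u g hg => ?_⟩
  set F := (finite_laplaceSymbol_le (d := d) ε⁻¹).toFinset with hF
  have hnorm : ε * ‖g‖ = ‖(ε : ℂ) • g‖ := by
    rw [norm_smul, Complex.norm_real, Real.norm_of_nonneg hε.le]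
  rw [hnorm]
  refine norm_le_of_forall_norm_repr_le UnitAddTorus.mFourierBasis fun k => ?_
  have hcoef : UnitAddTorus.mFourierBasis.repr
      (u - ∑ j ∈ F, fourierCoefficient u j • UnitAddTorus.mFourierBasis j) k =
      if k ∈ F then 0 else fourierCoefficient u k := by
    have horth := orthonormal_iff_ite.1 (UnitAddTorus.mFourierBasis (d := Fin d)).orthonormal k
    rw [HilbertBasis.repr_apply_apply, inner_sub_right, inner_sum,
      ← HilbertBasis.repr_apply_apply, repr_eq_fourierCoefficient]
    simp only [inner_smul_right, horth, mul_ite, mul_one, mul_zero, Finset.sum_ite_eq]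
    split_ifs <;> simp
  rw [hcoef, repr_eq_fourierCoefficient, fourierCoefficient_smul, hg]
  split_ifs with hk
  · rw [norm_zero]
    positivity
  · have hk' : ε⁻¹ < laplaceSymbol k := by
      simpa [hF] using hk
    have h1 : ‖(1 + (laplaceSymbol k : ℂ))‖ = 1 + laplaceSymbol k := by
      rw [← Complex.ofReal_one, ← Complex.ofReal_add, Complex.norm_real, Real.norm_of_nonneg]
      linarith [laplaceSymbol_nonneg k]
    rw [norm_mul, norm_mul, h1, Complex.norm_real, Real.norm_of_nonneg hε.le, ← mul_assoc]
    refine le_mul_of_one_le_left (norm_nonneg _) ?_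
    calc 1 = ε * ε⁻¹ := (mul_inv_cancel₀ hε.ne').symm
      _ ≤ ε * (1 + laplaceSymbol k) := by gcongr; linarith

/-! ### Truncated operators: symmetry, invertibility, continuity -/

theorem inner_negLaplacian_left (u w : sobolevH2 d) :
    inner ℂ (negLaplacian d u) (w : L2Torus d) = inner ℂ (u : L2Torus d) (negLaplacian d w) := by
  rw [← (UnitAddTorus.mFourierBasis (d := Fin d)).repr.inner_map_map,
    ← (UnitAddTorus.mFourierBasis (d := Fin d)).repr.inner_map_map, lp.inner_eq_tsum,
    lp.inner_eq_tsum]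
  refine tsum_congr fun k => ?_
  simp only [repr_eq_fourierCoefficient, fourierCoefficient_negLaplacian, RCLike.inner_apply,
    map_mul, Complex.conj_ofReal]
  ring

theorem truncSchrodinger_apply (K : L2Torus d →L[ℂ] L2Torus d) (v : ℕ → sobolevH2 d) (n : ℕ)
    (u : firstSpan v n) :
    truncSchrodinger K v n u = (firstSpan v n).orthogonalProjectionOnto
      (negLaplacian d ⟨u, firstSpan_le v n u.2⟩ + K u) := rfl

theorem isSymmetric_truncSchrodinger {K : L2Torus d →L[ℂ] L2Torus d} (hK : IsSelfAdjoint K)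
    (v : ℕ → sobolevH2 d) (n : ℕ) : (truncSchrodinger K v n).IsSymmetric := by
  intro u w
  set u' : sobolevH2 d := ⟨u, firstSpan_le v n u.2⟩
  set w' : sobolevH2 d := ⟨w, firstSpan_le v n w.2⟩
  have h : inner ℂ (negLaplacian d u' + K u') (w' : L2Torus d) =
      inner ℂ (u' : L2Torus d) (negLaplacian d w' + K w') := by
    have hKs : inner ℂ (K u') (w' : L2Torus d) = inner ℂ (u' : L2Torus d) (K w') :=
      hK.isSymmetric _ _
    rw [inner_add_left, inner_add_right, inner_negLaplacian_left, hKs]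
  exact (Submodule.inner_orthogonalProjectionOnto_eq_of_mem_right w _).trans
    (h.trans (Submodule.inner_orthogonalProjectionOnto_eq_of_mem_left u _).symm)

/-- The span of the first eigenvectors is invariant. -/
theorem apply_mem_firstSpan {H : Type*} [NormedAddCommGroup H] [InnerProductSpace ℂ H]
    {T : H →ₗ.[ℂ] H} {α : ℕ → ℝ} {v : ℕ → T.domain} (hv : IsEigenpairList T α v) {n : ℕ}
    {u : T.domain} (hu : (u : H) ∈ firstSpan v n) : T u ∈ firstSpan v n := by
  -- The span lives in `H` but `T` acts only on its domain, so invariance is checked on generators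
  -- after pushing the preimage forward to `H`.
  have hle : firstSpan v n ≤ ((firstSpan v n).comap T.toFun).map T.domain.subtype := by
    refine Submodule.span_le.2 ?_
    rintro _ ⟨i, rfl⟩
    refine ⟨v i, ?_, rfl⟩
    have h : T (v i) ∈ firstSpan v n := by
      rw [hv.eigen]
      exact Submodule.smul_mem _ _ (Submodule.subset_span ⟨i, rfl⟩)
    exact h
  obtain ⟨u', hu', h⟩ := hle hu
  have : u' = u := Subtype.ext h
  rw [← this]
  exact hu'

/-- If `(K - K₀) R` is a strict contraction, where `R` inverts `-Δ + K₀`, then all truncations of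
`-Δ + K` are invertible. -/
theorem zero_mem_resolventSet_truncSchrodinger {K₀ K R : L2Torus d →L[ℂ] L2Torus d}
    {α : ℕ → ℝ} {v : ℕ → sobolevH2 d} (hv : IsEigenpairList (schrodinger K₀) α v)
    (hR : ∀ u : sobolevH2 d, R (negLaplacian d u + K₀ u) = u)
    (hK : ∀ f ≠ 0, ‖(K - K₀) (R f)‖ < ‖f‖) (n : ℕ) :
    (0 : ℂ) ∈ resolventSet ℂ (truncSchrodinger K v n) := by
  rw [spectrum.mem_resolventSet_iff, map_zero, zero_sub]
  suffices h : IsUnit (truncSchrodinger K v n) from h.neg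
  rw [LinearMap.isUnit_iff_ker_eq_bot, LinearMap.ker_eq_bot']
  intro u hu
  set u' : sobolevH2 d := ⟨u, firstSpan_le v n u.2⟩ with hu'
  set f : L2Torus d := negLaplacian d u' + K₀ u' with hf
  have hfmem : f ∈ firstSpan v n := apply_mem_firstSpan (T := schrodinger K₀) hv (u := u') u.2
  have hRf : R f = u := hR u'
  have hsum : negLaplacian d u' + K u = f + (K - K₀) (R f) := by
    rw [hRf, hf, sub_apply]
    abel
  rw [truncSchrodinger_apply, hsum, map_add] at hu
  -- The projection fixes f and does not increase the norm of the perturbation.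
  have hle : ‖f‖ ≤ ‖(K - K₀) (R f)‖ := by
    rw [← Submodule.norm_orthogonalProjectionOnto_apply _ hfmem, eq_neg_of_add_eq_zero_left hu,
      norm_neg]
    exact Submodule.norm_orthogonalProjectionOnto_apply_le _ _
  have hf0 : f = 0 := by
    by_contra hne
    exact absurd (hK f hne) (not_lt.2 hle)
  rw [hf0, map_zero] at hRf
  exact Subtype.ext hRf.symm

/-- Strong convergence becomes convergence in norm after composition with the compact resolvent
of `-Δ + K₀`. -/
theorem eventually_norm_apply_resolvent_le {K₀ R : L2Torus d →L[ℂ] L2Torus d}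
    (hR : ∀ f, ∃ u : sobolevH2 d, (u : L2Torus d) = R f ∧ negLaplacian d u + K₀ u = f)
    {X : Type*} {p : Filter X} {B : X → L2Torus d →L[ℂ] L2Torus d} {C : ℝ}
    (hC : ∀ᶠ x in p, ‖B x‖ ≤ C) (hB : ∀ u, Tendsto (fun x => B x u) p (𝓝 0))
    {ε : ℝ} (hε : 0 < ε) : ∀ᶠ x in p, ∀ f, ‖B x (R f)‖ ≤ ε * ‖f‖ := by
  -- M bounds (1 - Δ)R, because -Δu = f - K₀u for u = Rf. The choice of η makes the high-frequency
  -- part cost ε/2; |C| + 1 keeps the denominator positive.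
  set M : ℝ := ‖R‖ + 1 + ‖K₀‖ * ‖R‖ with hM
  have hM0 : 0 < M := by positivity
  set η : ℝ := ε / (2 * (|C| + 1) * M) with hη
  have hη0 : 0 < η := by positivity
  obtain ⟨F, hF⟩ := exists_finset_norm_sub_fourier_sum_le (d := d) hη0
  have hlim : Tendsto (fun x => (∑ k ∈ F, ‖B x (UnitAddTorus.mFourierBasis k)‖) * ‖R‖) p
      (𝓝 0) := by
    have := (tendsto_finsetSum F fun k _ =>
      (hB (UnitAddTorus.mFourierBasis k)).norm).mul_const ‖R‖
    simpa using this
  filter_upwards [hC, hlim.eventually_le_const (half_pos hε)] with x hx hxF f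
  obtain ⟨u, huR, huf⟩ := hR f
  set uF := ∑ k ∈ F, fourierCoefficient (u : L2Torus d) k •
    (UnitAddTorus.mFourierBasis k : L2Torus d) with huF
  have hRf : ‖R f‖ ≤ ‖R‖ * ‖f‖ := R.le_opNorm f
  have hg : ‖(u : L2Torus d) + negLaplacian d u‖ ≤ M * ‖f‖ := by
    have h1 : (u : L2Torus d) + negLaplacian d u = R f + f - K₀ (R f) := by
      rw [← huR, ← huf]
      abel
    rw [h1]
    calc ‖R f + f - K₀ (R f)‖ ≤ ‖R f‖ + ‖f‖ + ‖K₀ (R f)‖ :=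
          (norm_sub_le _ _).trans (by gcongr; exact norm_add_le _ _)
      _ ≤ ‖R‖ * ‖f‖ + ‖f‖ + ‖K₀‖ * (‖R‖ * ‖f‖) := by
          gcongr
          exact (K₀.le_opNorm _).trans (by gcongr)
      _ = M * ‖f‖ := by rw [hM]; ring
  have htail : ‖(u : L2Torus d) - uF‖ ≤ η * (M * ‖f‖) := by
    refine (hF u (u + negLaplacian d u) fun k => ?_).trans (by gcongr)
    rw [fourierCoefficient_add, fourierCoefficient_negLaplacian]
    ring
  -- The low-frequency part involves only finitely many fixed vectors, where strong convergence
  -- suffices; each coefficient is at most ‖Rf‖.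
  have hhead : ‖B x uF‖ ≤ (∑ k ∈ F, ‖B x (UnitAddTorus.mFourierBasis k)‖) * ‖R‖ * ‖f‖ := by
    rw [huF, map_sum, Finset.sum_mul, Finset.sum_mul]
    refine (norm_sum_le _ _).trans (Finset.sum_le_sum fun k _ => ?_)
    rw [map_smul, norm_smul, mul_comm, mul_assoc]
    gcongr
    refine le_trans ?_ hRf
    rw [← huR, ← repr_eq_fourierCoefficient,
      ← (UnitAddTorus.mFourierBasis (d := Fin d)).repr.norm_map (u : L2Torus d)]
    exact lp.norm_apply_le_norm two_ne_zero _ _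
  have hηM : (|C| + 1) * (η * M) = ε / 2 := by
    rw [hη]
    field_simp
  calc ‖B x (R f)‖ = ‖B x (u - uF) + B x uF‖ := by rw [map_sub, sub_add_cancel, huR]
    _ ≤ ‖B x (u - uF)‖ + ‖B x uF‖ := norm_add_le _ _
    _ ≤ (|C| + 1) * (η * (M * ‖f‖)) + ε / 2 * ‖f‖ := by
        gcongr
        · refine (B x).le_of_opNorm_le_of_le ?_ htail
          linarith [le_abs_self C]
        · exact hhead.trans (by gcongr)
    _ = (|C| + 1) * (η * M) * ‖f‖ + ε / 2 * ‖f‖ := by ring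
    _ = ε * ‖f‖ := by rw [hηM]; ring

/-- A truncation depends continuously on the potential. -/
theorem continuousOn_truncSchrodinger_apply {K : ℝ → L2Torus d →L[ℂ] L2Torus d} (hK : HypH2 K)
    (v : ℕ → sobolevH2 d) (n : ℕ) (u : firstSpan v n) :
    ContinuousOn (fun l => truncSchrodinger (K l) v n u) (Ico 0 1) := by
  have h : ContinuousOn (fun l => K l u) (Ico (0 : ℝ) 1) := fun σ hσ => hK σ hσ u
  simp only [truncSchrodinger_apply]
  exact (ContinuousLinearMap.continuous _).comp_continuousOn (continuousOn_const.add h)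

end Torus

end TorusSchrodinger

/-! ### The main theorem -/

theorem mainTheorem4 (d : ℕ) (hd : 1 ≤ d)
    (K : ℝ → TorusSchrodinger.L2Torus d →L[ℂ] TorusSchrodinger.L2Torus d)
    (hH1 : TorusSchrodinger.HypH1 K) (hH2 : TorusSchrodinger.HypH2 K)
    (α : ℕ → ℝ) (v : ℕ → TorusSchrodinger.sobolevH2 d)
    (hv : TorusSchrodinger.IsEigenpairList (TorusSchrodinger.schrodinger (K 0)) α v)
    (h0 : TorusSchrodinger.MemResolventSet 0 (TorusSchrodinger.schrodinger (K 0))) :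
    (∃ (lstar : ℝ) (N : ℕ), TorusSchrodinger.IsAdmissible K v 0 lstar N) ∧
    ∀ (lstar : ℝ) (N : ℕ), TorusSchrodinger.IsAdmissible K v 0 lstar N →
      ∀ l ∈ Set.Ioo 0 lstar, ∀ n > N,
        TorusSchrodinger.neg (TorusSchrodinger.truncSchrodinger (K l) v n) =
          TorusSchrodinger.neg (TorusSchrodinger.truncSchrodinger (K 0) v n) := by
  open TorusSchrodinger in
  obtain ⟨hsa, C, hC⟩ := hH1
  obtain ⟨R, hR1, hR2⟩ := h0
  have hright : ∀ f, ∃ u : sobolevH2 d, (u : L2Torus d) = R f ∧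
      negLaplacian d u + K 0 u = f := fun f => by
    obtain ⟨u, hu, huf⟩ := hR1 f
    rw [zero_smul, sub_zero] at huf
    exact ⟨u, hu, huf⟩
  have hleft : ∀ u : sobolevH2 d, R (negLaplacian d u + K 0 u) = u := fun u => by
    have h := hR2 u
    rw [zero_smul, sub_zero] at h
    exact h
  have h00 : (0 : ℝ) ∈ Ico (0 : ℝ) 1 := ⟨le_rfl, one_pos⟩
  refine ⟨?_, ?_⟩
  · have hev : ∀ᶠ l in 𝓝[Ico (0 : ℝ) 1] 0, ∀ f, ‖(K l - K 0) (R f)‖ ≤ 1 / 2 * ‖f‖ := by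
      refine eventually_norm_apply_resolvent_le (C := C + C) hright ?_ (fun u => ?_) one_half_pos
      · filter_upwards [self_mem_nhdsWithin] with l hl
        exact (norm_sub_le _ _).trans (add_le_add (hC l hl) (hC 0 h00))
      · simpa using (hH2 0 h00 u).sub_const (K 0 u)
    obtain ⟨δ, hδ, hball⟩ := Metric.mem_nhdsWithin_iff.1 hev
    -- N = 0 works because the contraction bound does not involve n.
    refine ⟨min δ 1, 0, lt_min hδ one_pos, min_le_right _ _, fun n _ l hl => ?_⟩
    refine zero_mem_resolventSet_truncSchrodinger hv hleft (fun f hf => ?_) n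
    have hl' : l ∈ Metric.ball (0 : ℝ) δ ∩ Ico 0 1 := by
      refine ⟨?_, hl.1.le, hl.2.trans_le (min_le_right _ _)⟩
      rw [Metric.mem_ball, Real.dist_0_eq_abs, abs_of_pos hl.1]
      exact hl.2.trans_le (min_le_left _ _)
    have h1 : ‖(K l - K 0) (R f)‖ ≤ 1 / 2 * ‖f‖ := hball hl' f
    have h2 := norm_pos_iff.2 hf
    linarith
  · rintro lstar N ⟨hpos, hle, hadm⟩ l hl n hn
    have hsub : Ico 0 lstar ⊆ Ico (0 : ℝ) 1 := Ico_subset_Ico_right hle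
    refine neg_eq_of_isPreconnected (T := fun l => truncSchrodinger (K l) v n)
      (isPreconnected_Ico (a := (0 : ℝ)) (b := lstar))
      (fun x hx => isSymmetric_truncSchrodinger (hsa x (hsub hx)) v n)
      (fun u => (continuousOn_truncSchrodinger_apply hH2 v n u).mono hsub) (fun x hx => ?_)
      ⟨hl.1.le, hl.2⟩ ⟨le_rfl, hpos⟩
    -- Admissibility says nothing at λ = 0, the endpoint that the path must reach; there the
    -- perturbation vanishes, so the contraction criterion holds trivially.
    rcases hx.1.eq_or_lt with rfl | hx0
    · refine zero_mem_resolventSet_truncSchrodinger hv hleft (fun f hf => ?_) n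
      simpa using hf
    · exact hadm n hn x ⟨hx0, hx.2⟩
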